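/- Theorem 1.2 (Properties on Besov spaces). Let $d,m\ge 1$. For $0<s<1$ and $1<p,q<\infty$ let $B_s^{p,q}(\mathbb{R}^d)$ be the Besov space of all (real- or complex-valued) functions $f\in L^p(\mathbb{R}^d)$ with $$\|f\|_{B_s^{p,q}(\mathbb{R}^d)}:=\|f\|_{L^p(\mathbb{R}^d)}+\Big(\int_{\mathbb{R}^d}\frac{\|f(\cdot+h)-f\|_{L^p(\mathbb{R}^d)}^q}{|h|^{d+sq}}\,dh\Big)^{1/q}<\infty .$$ For $\vec f=(f_1,\dots,f_m)$ with locally integrable $f_i$, let $$\mathscr{M}_{\mathcal R}(\vec f)(x)=\sup_{R\in\mathcal R,\ R\ni x}\ \prod_{i=1}^m\frac1{|R|}\int_R|f_i(y)|\,dy ,\qquad x\in\mathbb{R}^d,$$ where $\mathcal R$ is the family of all open rectangles in $\mathbb{R}^d$ with sides parallel to the coordinate axes. Let $0<s<1$ and $1<p_1,\dots,p_m,p,q<\infty$ with $1/p=\sum_{i=1}^m 1/p_i$. Then $\mathscr{M}_{\mathcal R}$ is bounded and continuous from $B_s^{p_1,q}(\mathbb{R}^d)\times\cdots\times B_s^{p_m,q}(\mathbb{R}^d)$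 to $B_s^{p,q}(\mathbb{R}^d)$. That is: (i) there is a constant $C$, depending only on $d,m,s,q,p_1,\dots,p_m$, such that whenever $f_i\in B_s^{p_i,q}(\mathbb{R}^d)$ for all $i$, the function $\mathscr{M}_{\mathcal R}(\vec f)$ is finite almost everywhere, belongs to $B_s^{p,q}(\mathbb{R}^d)$, and $$\|\mathscr{M}_{\mathcal R}(\vec f)\|_{B_s^{p,q}(\mathbb{R}^d)}\le C\prod_{i=1}^m\|f_i\|_{B_s^{p_i,q}(\mathbb{R}^d)};$$ (ii) for every $\vec f$ with $f_i\in B_s^{p_i,q}(\mathbb{R}^d)$ and every $\varepsilon>0$ there is $\delta>0$ such that $\|\mathscr{M}_{\mathcal R}(\vec g)-\mathscr{M}_{\mathcal R}(\vec f)\|_{B_s^{p,q}(\mathbb{R}^d)}<\varepsilon$ for every $\vec g$ with $g_i\in B_s^{p_i,q}(\mathbb{R}^d)$ and $\|g_i-f_i\|_{B_s^{p_i,q}(\mathbb{R}^d)}<\delta$, $1\le i\le m$. -/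

import Mathlib

open MeasureTheory
open scoped ENNReal NNReal

/-- The open rectangle `∏ⱼ (aⱼ, bⱼ)` in `ℝ^d`, with sides parallel to the coordinate axes. -/
def openRectangle {d : ℕ} (a b : Fin d → ℝ) : Set (EuclideanSpace ℝ (Fin d)) :=
  {y | ∀ j, a j < y j ∧ y j < b j}

/-- The multilinear strong maximal function, with values in `[0, ∞]`: the supremum, over all
open rectangles `R` with sides parallel to the axes that contain `x`, of
`∏ᵢ (1/|R|) ∫_R |fᵢ(y)| dy`. -/
noncomputable def strongMaximal {d m : ℕ} {𝕜 : Type*} [RCLike 𝕜]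
    (f : Fin m → EuclideanSpace ℝ (Fin d) → 𝕜) (x : EuclideanSpace ℝ (Fin d)) : ℝ≥0∞ :=
  ⨆ (a : Fin d → ℝ) (b : Fin d → ℝ) (_ : x ∈ openRectangle a b),
    ∏ i, (volume (openRectangle a b))⁻¹ * ∫⁻ y in openRectangle a b, ‖f i y‖ₑ

/-- The multilinear strong maximal function as a real-valued function. It takes the value `0`
where `strongMaximal f` is infinite, so it represents `strongMaximal f` almost everywhere as soon
as the latter is finite almost everywhere. -/
noncomputable def strongMaximalReal {d m : ℕ} {𝕜 : Type*} [RCLike 𝕜]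
    (f : Fin m → EuclideanSpace ℝ (Fin d) → 𝕜) (x : EuclideanSpace ℝ (Fin d)) : ℝ :=
  (strongMaximal f x).toReal

/-- The homogeneous Besov seminorm of smoothness `s` with `0 < s < 1`,
`(∫_{ℝ^d} ‖f(· + h) - f‖_{L^p}^q |h|^{-(d + s q)} dh)^{1/q}`. -/
noncomputable def besovSeminorm {d : ℕ} {𝕜 : Type*} [RCLike 𝕜] (s p q : ℝ)
    (f : EuclideanSpace ℝ (Fin d) → 𝕜) : ℝ≥0∞ :=
  (∫⁻ h : EuclideanSpace ℝ (Fin d),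
    (eLpNorm (fun x => f (x + h) - f x) (ENNReal.ofReal p) volume) ^ q
      / ‖h‖ₑ ^ ((d : ℝ) + s * q)) ^ (1 / q)

/-- The (inhomogeneous) Besov norm `‖f‖_{L^p} + |f|_{s,p,q}`. -/
noncomputable def besovNorm {d : ℕ} {𝕜 : Type*} [RCLike 𝕜] (s p q : ℝ)
    (f : EuclideanSpace ℝ (Fin d) → 𝕜) : ℝ≥0∞ :=
  eLpNorm f (ENNReal.ofReal p) volume + besovSeminorm s p q f

/-- Membership in the Besov space `B_s^{p,q}(ℝ^d)`. -/
def MemBesov {d : ℕ} {𝕜 : Type*} [RCLike 𝕜] (s p q : ℝ)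
    (f : EuclideanSpace ℝ (Fin d) → 𝕜) : Prop :=
  AEStronglyMeasurable f volume ∧ besovNorm s p q f < ∞

/-! The strong maximal operator commutes with translations and is sublinear in each entry, so its
Besov bounds follow from L^p bounds alone.

On L^p, the one-dimensional maximal function is bounded by Vitali covering and truncation. Applying
it in each coordinate in turn gives a single L^p function that dominates all rectangle averages
(`exists_average_openRectangle_majorant`), and Hölder's inequality handles the product of the m
averages. Telescoping the product bounds |Mf - Mg| pointwise by a sum of maximal functions, each
with one entry |f_i - g_i| (`eLpNorm_strongMaximalReal_sub_le`). Comparing f(· + h) with f then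
bounds the L^p modulus of Mf at h by those of the f_i (`lpModulus_strongMaximalReal_le`), and the
L^q norm against |h|^{-(d+sq)} dh gives boundedness.

Continuity needs more, because Mg - Mf is not itself a maximal function. Its modulus at h has two
bounds: twice its L^p norm, which is O(δ) uniformly in h, and a fixed multiple of the moduli of the
f_i plus those of the g_i - f_i. The minimum of the O(δ) constant with the fixed part tends to 0 in
L^q by dominated convergence (`tendsto_eLpNorm_min_const`). -/

/-! ### The maximal function on the line -/

theorem ENNReal.lintegral_Ioi_rpow_layer {r : ℝ} (hr : 0 < r) (y : ℝ≥0∞) :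
    ENNReal.ofReal r * ∫⁻ t in Set.Ioi (0 : ℝ),
      Set.indicator {t : ℝ | ENNReal.ofReal t < y} (fun t => ENNReal.ofReal (t ^ (r - 1))) t
      = y ^ r := by
  have key : ∀ c : ℝ≥0, ENNReal.ofReal r * ∫⁻ t in Set.Ioi (0 : ℝ),
      Set.indicator {t : ℝ | ENNReal.ofReal t < c} (fun t => ENNReal.ofReal (t ^ (r - 1))) t
      = (c : ℝ≥0∞) ^ r := by
    intro c
    -- A unit mass at a point turns the layer cake formula into an identity for one number.
    have h := lintegral_rpow_eq_lintegral_meas_lt_mul (Measure.dirac ()) (f := fun _ => (c : ℝ))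
      (Filter.Eventually.of_forall fun _ => c.2) aemeasurable_const hr
    rw [lintegral_dirac] at h
    have h2 : ENNReal.ofReal ((c : ℝ) ^ r) = (c : ℝ≥0∞) ^ r := by
      rw [← NNReal.coe_rpow, ENNReal.ofReal_coe_nnreal, ENNReal.coe_rpow_of_nonneg _ hr.le]
    rw [← h2, h]
    congr 1
    refine setLIntegral_congr_fun measurableSet_Ioi fun t ht => ?_
    have ht : 0 < t := ht
    by_cases htc : t < c
    · have : ENNReal.ofReal t < c := by
        rw [← ENNReal.ofReal_coe_nnreal]
        exact (ENNReal.ofReal_lt_ofReal_iff (ht.trans htc)).2 htc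
      simp [Set.indicator, htc, this]
    · have : ¬ ENNReal.ofReal t < c := by
        rw [← ENNReal.ofReal_coe_nnreal, not_lt]
        exact ENNReal.ofReal_le_ofReal (not_lt.1 htc)
      simp [Set.indicator, htc, this]
  induction y using ENNReal.recTopCoe with
  | coe c => exact key c
  | top =>
    rw [ENNReal.top_rpow_of_pos hr]
    refine ENNReal.eq_top_of_forall_nnreal_le fun c => ?_
    -- Every finite c is an r-th power, so monotonicity in y pushes the left side above all finite
    -- values.
    have hc : (c : ℝ≥0∞) = ((c ^ (1 / r) : ℝ≥0) : ℝ≥0∞) ^ r := by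
      rw [← ENNReal.coe_rpow_of_nonneg _ hr.le, ← NNReal.rpow_mul]
      simp [hr.ne']
    rw [hc, ← key]
    gcongr with t
    exact le_top

/-- The maximal function on the line over intervals with rational endpoints. -/
noncomputable def ratIntervalMaximal (f : ℝ → ℝ≥0∞) (t : ℝ) : ℝ≥0∞ :=
  ⨆ (a : ℚ) (b : ℚ) (_ : t ∈ Set.Ioo (a : ℝ) b),
    (ENNReal.ofReal (b - a))⁻¹ * ∫⁻ y in Set.Ioo (a : ℝ) b, f y

/-- Weak type (1,1) by Vitali: disjoint intervals with average at least l, enlarged five times,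
cover the level set. Rational endpoints keep the family countable, so no measurability of f is
needed. -/
theorem mul_volume_ratIntervalMaximal_lt_le (f : ℝ → ℝ≥0∞)
    {l : ℝ≥0∞} (hl : 0 < l) (hl' : l ≠ ∞) :
    l * volume {t | l < ratIntervalMaximal f t} ≤ 5 * ∫⁻ y, f y := by
  rcases eq_or_ne (∫⁻ y, f y) ∞ with hI | hI
  · simp [hI]
  let T : Set (ℚ × ℚ) := {c | (c.1 : ℝ) < c.2 ∧
    l * ENNReal.ofReal (c.2 - c.1) ≤ ∫⁻ y in Set.Ioo (c.1 : ℝ) c.2, f y}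
  let xc : ℚ × ℚ → ℝ := fun c => (c.1 + c.2) / 2
  let rc : ℚ × ℚ → ℝ := fun c => ((c.2 : ℝ) - c.1) / 2
  have hball : ∀ c, Metric.closedBall (xc c) (rc c) = Set.Icc (c.1 : ℝ) c.2 := by
    intro c
    rw [Real.closedBall_eq_Icc]
    congr 1 <;> simp only [xc, rc] <;> ring
  -- Vitali's lemma needs bounded radii: an average of at least l forces length at most ∫ f / l,
  -- which is finite here.
  have hR : ∀ c ∈ T, rc c ≤ ((∫⁻ y, f y) / l).toReal := by
    intro c hc
    have h1 : ENNReal.ofReal (c.2 - c.1) ≤ (∫⁻ y, f y) / l := by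
      rw [ENNReal.le_div_iff_mul_le (Or.inl hl.ne') (Or.inl hl'), mul_comm]
      exact hc.2.trans (setLIntegral_le_lintegral _ _)
    have h2 := (ENNReal.ofReal_le_iff_le_toReal (ENNReal.div_ne_top hI hl.ne')).1 h1
    have := hc.1
    simp only [rc]
    linarith
  obtain ⟨u, huT, hdisj, hcov⟩ :=
    Vitali.exists_disjoint_subfamily_covering_enlargement_closedBall T xc rc _ hR 5
      (by norm_num)
  have hsub : {t | l < ratIntervalMaximal f t} ⊆ ⋃ c ∈ u, Metric.closedBall (xc c) (5 * rc c) := by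
    intro t ht
    simp only [ratIntervalMaximal, Set.mem_ofPred_eq, lt_iSup_iff] at ht
    obtain ⟨a, b, htab, hlt⟩ := ht
    have hab : (a : ℝ) < b := htab.1.trans htab.2
    have hpos : ENNReal.ofReal ((b : ℝ) - a) ≠ 0 := by simpa using hab
    have hmem : (a, b) ∈ T := by
      refine ⟨hab, ?_⟩
      rw [mul_comm] at hlt
      have := (ENNReal.lt_div_iff_mul_lt (Or.inl hpos) (Or.inl ENNReal.ofReal_ne_top)).1
        (by simpa [div_eq_mul_inv] using hlt)
      exact this.le
    obtain ⟨c, hcu, hc⟩ := hcov _ hmem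
    refine Set.mem_biUnion hcu (hc ?_)
    rw [hball]
    exact Set.Ioo_subset_Icc_self htab
  have hvol : ∀ c ∈ u, l * volume (Metric.closedBall (xc c) (5 * rc c))
      ≤ 5 * ∫⁻ y in Metric.closedBall (xc c) (rc c), f y := by
    intro c hc
    rw [Real.volume_closedBall, show 2 * (5 * rc c) = 5 * (c.2 - c.1) by simp only [rc]; ring,
      ENNReal.ofReal_mul (by norm_num), mul_left_comm]
    have h5 : ENNReal.ofReal 5 = 5 := by simp
    rw [h5, hball]
    gcongr
    exact (huT hc).2.trans (lintegral_mono_set Set.Ioo_subset_Icc_self)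
  have hu : u.Countable := Set.to_countable u
  calc l * volume {t | l < ratIntervalMaximal f t}
      ≤ l * ∑' c : u, volume (Metric.closedBall (xc c) (5 * rc c)) := by
        gcongr
        exact (measure_mono hsub).trans (measure_biUnion_le _ hu _)
    _ = ∑' c : u, l * volume (Metric.closedBall (xc c) (5 * rc c)) := ENNReal.tsum_mul_left.symm
    _ ≤ ∑' c : u, 5 * ∫⁻ y in Metric.closedBall (xc c) (rc c), f y :=
        ENNReal.tsum_le_tsum fun c => hvol c c.2
    _ = 5 * ∑' c : u, ∫⁻ y in Metric.closedBall (xc c) (rc c), f y := ENNReal.tsum_mul_left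
    _ = 5 * ∫⁻ y in ⋃ c ∈ u, Metric.closedBall (xc c) (rc c), f y := by
        rw [lintegral_biUnion hu (fun _ _ => measurableSet_closedBall) hdisj]
    _ ≤ 5 * ∫⁻ y, f y := mul_le_mul_right (setLIntegral_le_lintegral _ _) _

/-- The supremum is countable because the endpoints are rational. The parameter x serves the later
iteration, where the maximal function acts on slices. -/
theorem measurable_ratIntervalMaximal_slice {α : Type*} [MeasurableSpace α] {f : α → ℝ → ℝ≥0∞}
    (hf : Measurable (Function.uncurry f)) {g : α → ℝ} (hg : Measurable g) :
    Measurable fun x => ratIntervalMaximal (f x) (g x) := by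
  unfold ratIntervalMaximal
  refine Measurable.iSup fun a => Measurable.iSup fun b => ?_
  have h : Measurable fun x => (ENNReal.ofReal ((b : ℝ) - a))⁻¹ *
      ∫⁻ y in Set.Ioo (a : ℝ) b, f x y := hf.lintegral_prod_right'.const_mul _
  have hs : MeasurableSet (g ⁻¹' Set.Ioo (a : ℝ) b) := hg measurableSet_Ioo
  convert h.indicator hs using 1
  ext x
  by_cases hx : g x ∈ Set.Ioo (a : ℝ) b
  · rw [Set.indicator_of_mem (by exact hx), iSup_pos hx]
  · rw [Set.indicator_of_notMem (by exact hx), iSup_neg hx, bot_eq_zero]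

/-- The part of f at height at most l contributes at most l to any average. -/
theorem ratIntervalMaximal_le_add (f : ℝ → ℝ≥0∞) (l : ℝ≥0∞) (t : ℝ) :
    ratIntervalMaximal f t ≤ ratIntervalMaximal ({y | l < f y}.indicator f) t + l := by
  refine iSup_le fun a => iSup_le fun b => iSup_le fun ht => ?_
  have hab : (a : ℝ) < b := ht.1.trans ht.2
  have hpos : ENNReal.ofReal ((b : ℝ) - a) ≠ 0 := by simpa using hab
  calc (ENNReal.ofReal ((b : ℝ) - a))⁻¹ * ∫⁻ y in Set.Ioo (a : ℝ) b, f y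
      ≤ (ENNReal.ofReal ((b : ℝ) - a))⁻¹ *
        ∫⁻ y in Set.Ioo (a : ℝ) b, ({y | l < f y}.indicator f y + l) := by
        refine mul_le_mul_right (lintegral_mono fun y => ?_) _
        by_cases hy : l < f y
        · rw [Set.indicator_of_mem (by exact hy)]; exact le_self_add
        · exact (not_lt.1 hy).trans le_add_self
    _ = (ENNReal.ofReal ((b : ℝ) - a))⁻¹ *
        (∫⁻ y in Set.Ioo (a : ℝ) b, {y | l < f y}.indicator f y) + l := by
        rw [lintegral_add_right _ measurable_const, mul_add, setLIntegral_const, Real.volume_Ioo,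
          mul_left_comm, ENNReal.inv_mul_cancel hpos ENNReal.ofReal_ne_top, mul_one]
    _ ≤ _ := add_le_add (le_iSup_of_le a (le_iSup_of_le b (by rw [iSup_pos ht]))) le_rfl

/-- Marcinkiewicz interpolation between the weak type bound and the trivial L^∞ bound, via the layer
cake formula and Tonelli. -/
theorem lintegral_ratIntervalMaximal_rpow_le {p : ℝ} (hp : 1 < p) :
    ∃ C : ℝ≥0, ∀ f : ℝ → ℝ≥0∞, Measurable f →
      ∫⁻ t, ratIntervalMaximal f t ^ p ≤ C * ∫⁻ t, f t ^ p := by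
  have hp0 : 0 < p := by linarith
  have hp1 : 0 < p - 1 := by linarith
  have h2p : (2 : ℝ≥0∞) ^ p ≠ ∞ := ENNReal.rpow_ne_top_of_nonneg hp0.le (by simp)
  -- The factors come from halving M, the outer layer cake, the weak type bound, and the inner layer
  -- cake with exponent p - 1.
  let K : ℝ≥0∞ := 2 ^ p * (ENNReal.ofReal p * (5 * (ENNReal.ofReal (p - 1))⁻¹))
  have hp1' : ENNReal.ofReal (p - 1) ≠ 0 := by simpa using hp
  have hK : K ≠ ∞ := by
    refine ENNReal.mul_ne_top h2p (ENNReal.mul_ne_top ENNReal.ofReal_ne_top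
      (ENNReal.mul_ne_top (by simp) ?_))
    simpa using hp
  refine ⟨K.toNNReal, fun f hf => ?_⟩
  rw [ENNReal.coe_toNNReal hK]
  set M := ratIntervalMaximal f
  have hMm : Measurable M :=
    measurable_ratIntervalMaximal_slice (α := ℝ) (f := fun _ => f) (hf.comp measurable_snd)
      measurable_id
  have hN : Measurable fun t => M t / 2 := hMm.div_const 2
  -- Where M f exceeds 2l, the maximal function of f truncated to {f > l} exceeds l.
  have hweak : ∀ l : ℝ, 0 < l → ENNReal.ofReal l * volume {t | ENNReal.ofReal l < M t / 2} ≤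
      5 * ∫⁻ y, {y | ENNReal.ofReal l < f y}.indicator f y := by
    intro l hl
    have hl' : 0 < ENNReal.ofReal l := ENNReal.ofReal_pos.2 hl
    refine le_trans ?_ (mul_volume_ratIntervalMaximal_lt_le _ hl' ENNReal.ofReal_ne_top)
    refine mul_le_mul_right (measure_mono fun t ht => ?_) _
    simp only [Set.mem_ofPred_eq] at ht ⊢
    rw [ENNReal.lt_div_iff_mul_lt (Or.inl (by simp)) (Or.inl (by simp)), mul_two] at ht
    exact lt_of_add_lt_add_right (ht.trans_le (ratIntervalMaximal_le_add f _ t))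
  have hmeas : ∀ (F : ℝ → ℝ≥0∞), Measurable F → ∀ r : ℝ, Measurable fun z : ℝ × ℝ =>
      Set.indicator {t : ℝ | ENNReal.ofReal t < F z.1} (fun t => ENNReal.ofReal (t ^ r)) z.2 := by
    intro F hF r
    have : Measurable fun z : ℝ × ℝ => ENNReal.ofReal (z.2 ^ r) := by fun_prop
    exact this.indicator (measurableSet_lt (ENNReal.measurable_ofReal.comp measurable_snd)
      (hF.comp measurable_fst))
  calc ∫⁻ t, M t ^ p = ∫⁻ t, 2 ^ p * (M t / 2) ^ p := by
        refine lintegral_congr fun t => ?_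
        rw [← ENNReal.mul_rpow_of_nonneg _ _ hp0.le, ENNReal.mul_div_cancel (by simp) (by simp)]
    _ = 2 ^ p * ∫⁻ x, (M x / 2) ^ p := lintegral_const_mul _ (hN.pow_const p)
    _ = 2 ^ p * ∫⁻ x, ENNReal.ofReal p * ∫⁻ t in Set.Ioi (0 : ℝ),
          Set.indicator {t : ℝ | ENNReal.ofReal t < M x / 2}
            (fun t => ENNReal.ofReal (t ^ (p - 1))) t := by
        simp_rw [ENNReal.lintegral_Ioi_rpow_layer hp0]
    _ = 2 ^ p * (ENNReal.ofReal p * ∫⁻ x, ∫⁻ t in Set.Ioi (0 : ℝ),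
          Set.indicator {t : ℝ | ENNReal.ofReal t < M x / 2}
            (fun t => ENNReal.ofReal (t ^ (p - 1))) t) := by
        rw [lintegral_const_mul]
        exact (hmeas _ hN (p - 1)).lintegral_prod_right'
    _ = 2 ^ p * (ENNReal.ofReal p * ∫⁻ t in Set.Ioi (0 : ℝ), ∫⁻ x,
          Set.indicator {t : ℝ | ENNReal.ofReal t < M x / 2}
            (fun t => ENNReal.ofReal (t ^ (p - 1))) t) := by
        rw [lintegral_lintegral_swap (hmeas _ hN (p - 1)).aemeasurable]
    _ ≤ 2 ^ p * (ENNReal.ofReal p * ∫⁻ t in Set.Ioi (0 : ℝ), 5 * ∫⁻ x, f x *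
          Set.indicator {t : ℝ | ENNReal.ofReal t < f x}
            (fun t => ENNReal.ofReal (t ^ (p - 1 - 1))) t) := by
        gcongr 2 ^ p * (ENNReal.ofReal p * ?_)
        refine setLIntegral_mono' measurableSet_Ioi fun t ht => ?_
        have ht : 0 < t := ht
        have e1 : ∫⁻ x, Set.indicator {t : ℝ | ENNReal.ofReal t < M x / 2}
            (fun t => ENNReal.ofReal (t ^ (p - 1))) t =
            ENNReal.ofReal (t ^ (p - 1)) * volume {x | ENNReal.ofReal t < M x / 2} := by
          rw [← setLIntegral_const, ← lintegral_indicator (measurableSet_lt measurable_const hN)]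
          rfl
        have e2 : ∫⁻ x, f x * Set.indicator {t : ℝ | ENNReal.ofReal t < f x}
            (fun t => ENNReal.ofReal (t ^ (p - 1 - 1))) t =
            ENNReal.ofReal (t ^ (p - 1 - 1)) * ∫⁻ x, {y | ENNReal.ofReal t < f y}.indicator f x := by
          rw [← lintegral_const_mul _ (hf.indicator (measurableSet_lt measurable_const hf))]
          refine lintegral_congr fun x => ?_
          by_cases hx : ENNReal.ofReal t < f x <;> simp [Set.indicator, hx, mul_comm]
        rw [e1, e2]
        -- One power of t is split off to serve as the level in the weak type bound.
        have e3 : t ^ (p - 1) = t ^ (p - 1 - 1) * t := by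
          rw [Real.rpow_sub_one ht.ne' (p - 1)]; field_simp
        rw [e3, ENNReal.ofReal_mul (by positivity), mul_assoc, mul_left_comm 5]
        exact mul_le_mul_right (hweak t ht) _
    _ = 2 ^ p * (ENNReal.ofReal p * (5 * ∫⁻ x, f x * ∫⁻ t in Set.Ioi (0 : ℝ),
          Set.indicator {t : ℝ | ENNReal.ofReal t < f x}
            (fun t => ENNReal.ofReal (t ^ (p - 1 - 1))) t)) := by
        have hm := (hf.comp measurable_fst).mul (hmeas f hf (p - 1 - 1))
        rw [lintegral_const_mul, ← lintegral_lintegral_swap]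
        · congr 3
          refine lintegral_congr fun x => ?_
          rw [lintegral_const_mul]
          exact (hmeas f hf (p - 1 - 1)).comp measurable_prodMk_left
        · exact hm.aemeasurable
        · exact hm.lintegral_prod_left'
    _ = 2 ^ p * (ENNReal.ofReal p * (5 * ∫⁻ x, (ENNReal.ofReal (p - 1))⁻¹ * f x ^ p)) := by
        congr 3
        refine lintegral_congr fun x => ?_
        have h := ENNReal.lintegral_Ioi_rpow_layer hp1 (f x)
        have hx : f x ^ p = f x * f x ^ (p - 1) := by
          conv_lhs => rw [show p = 1 + (p - 1) by ring]
          rw [ENNReal.rpow_add_of_nonneg _ _ zero_le_one hp1.le, ENNReal.rpow_one]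
        rw [hx, ← h, mul_left_comm (f x), ← mul_assoc (ENNReal.ofReal (p - 1))⁻¹,
          ENNReal.inv_mul_cancel hp1' ENNReal.ofReal_ne_top, one_mul]
    _ = K * ∫⁻ t, f t ^ p := by
        rw [lintegral_const_mul _ (hf.pow_const p)]
        simp only [K]; ring

/-! ### Iteration over the coordinates -/

theorem exists_rat_Ioo_superset {a b : ℝ} (hab : a < b) :
    ∃ a' b' : ℚ, (a' : ℝ) ≤ a ∧ b ≤ b' ∧ (b' : ℝ) - a' ≤ 2 * (b - a) := by
  obtain ⟨a', h1, h2⟩ := exists_rat_btwn (show a - (b - a) / 2 < a by linarith)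
  obtain ⟨b', h3, h4⟩ := exists_rat_btwn (show b < b + (b - a) / 2 by linarith)
  exact ⟨a', b', h2.le, h3.le, by linarith⟩

/-- Any interval lies in a rational one at most twice as long, hence the factor 2. -/
theorem average_Ioo_le_ratIntervalMaximal (f : ℝ → ℝ≥0∞) {a b t : ℝ} (ht : t ∈ Set.Ioo a b) :
    (ENNReal.ofReal (b - a))⁻¹ * ∫⁻ y in Set.Ioo a b, f y ≤ 2 * ratIntervalMaximal f t := by
  obtain ⟨a', b', ha, hb, hl⟩ := exists_rat_Ioo_superset (ht.1.trans ht.2)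
  have h1 : (ENNReal.ofReal (b - a))⁻¹ ≤ 2 * (ENNReal.ofReal ((b' : ℝ) - a'))⁻¹ := by
    rw [← div_eq_mul_inv, ENNReal.inv_le_iff_inv_le, ENNReal.inv_div (by simp) (by simp)]
    refine ENNReal.div_le_of_le_mul ?_
    rw [← ENNReal.ofReal_ofNat 2, ← ENNReal.ofReal_mul' (by norm_num)]
    exact ENNReal.ofReal_le_ofReal (by linarith)
  calc (ENNReal.ofReal (b - a))⁻¹ * ∫⁻ y in Set.Ioo a b, f y
      ≤ (2 * (ENNReal.ofReal ((b' : ℝ) - a'))⁻¹) * ∫⁻ y in Set.Ioo (a' : ℝ) b', f y :=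
        mul_le_mul' h1 (lintegral_mono_set (Set.Ioo_subset_Ioo ha hb))
    _ = 2 * ((ENNReal.ofReal ((b' : ℝ) - a'))⁻¹ * ∫⁻ y in Set.Ioo (a' : ℝ) b', f y) := mul_assoc _ _ _
    _ ≤ _ := by
        refine mul_le_mul_right ?_ _
        exact le_iSup_of_le a' (le_iSup_of_le b'
          (by rw [iSup_pos ⟨ha.trans_lt ht.1, ht.2.trans_le hb⟩]))

/-- The uniform probability measure on the interval `(a, b)`. -/
noncomputable def uniformIoo (a b : ℝ) : Measure ℝ :=
  (ENNReal.ofReal (b - a))⁻¹ • volume.restrict (Set.Ioo a b)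

/-- Needed for marginals with arbitrary endpoints; for b ≤ a the scalar is infinite but the
restricted measure vanishes. -/
instance (a b : ℝ) : SigmaFinite (uniformIoo a b) := by
  rcases lt_or_ge a b with h | h
  · have : (ENNReal.ofReal (b - a))⁻¹ ≠ ∞ := by simpa using h
    lift (ENNReal.ofReal (b - a))⁻¹ to ℝ≥0 using this with c hc
    have : uniformIoo a b = c • volume.restrict (Set.Ioo a b) := by
      rw [uniformIoo, ← hc]; rfl
    rw [this]; infer_instance
  · have : uniformIoo a b = 0 := by simp [uniformIoo, Set.Ioo_eq_empty_of_le h]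
    rw [this]; infer_instance

/-- Induction on the set of averaged coordinates: the one-dimensional maximal function in the new
coordinate is applied to the previous majorant. Since g does not depend on a and b, it controls all
rectangles at once. -/
theorem exists_lmarginal_uniformIoo_majorant {ι : Type*} [Fintype ι] [DecidableEq ι] {p : ℝ}
    (hp : 1 < p) (s : Finset ι) :
    ∃ C : ℝ≥0, ∀ f : (ι → ℝ) → ℝ≥0∞, Measurable f → ∃ g : (ι → ℝ) → ℝ≥0∞, Measurable g ∧
      (∀ a b x : ι → ℝ, (∀ i, x i ∈ Set.Ioo (a i) (b i)) →
        (∫⋯∫⁻_s, f ∂fun i => uniformIoo (a i) (b i)) x ≤ g x) ∧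
      ∫⁻ x, g x ^ p ≤ C * ∫⁻ x, f x ^ p := by
  have hp0 : 0 < p := by linarith
  induction s using Finset.induction with
  | empty => exact ⟨1, fun f hf => ⟨f, hf, by simp, by simp⟩⟩
  | insert j s hj ih =>
    obtain ⟨C, ih⟩ := ih
    obtain ⟨C₁, hC₁⟩ := lintegral_ratIntervalMaximal_rpow_le hp
    refine ⟨2 ^ p * C₁ * C, fun f hf => ?_⟩
    obtain ⟨g, hg, hfg, hint⟩ := ih f hf
    have hslice : Measurable (Function.uncurry fun (x : ι → ℝ) (t : ℝ) =>
        g (Function.update x j t)) := by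
      refine hg.comp (measurable_pi_lambda _ fun i => ?_)
      rcases eq_or_ne i j with rfl | h
      · simpa using measurable_snd
      · simp only [Function.update_of_ne h]; fun_prop
    let M : (ι → ℝ) → ℝ≥0∞ := fun x => ratIntervalMaximal (fun t => g (Function.update x j t)) (x j)
    have hM : Measurable M := measurable_ratIntervalMaximal_slice hslice (measurable_pi_apply j)
    refine ⟨fun x => 2 * M x, hM.const_mul 2, fun a b x hx => ?_, ?_⟩
    · rw [lmarginal_insert _ hf hj]
      refine le_trans ?_ (average_Ioo_le_ratIntervalMaximal _ (hx j))
      rw [uniformIoo, lintegral_smul_measure, smul_eq_mul]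
      refine mul_le_mul_right (setLIntegral_mono' measurableSet_Ioo fun t ht => ?_) _
      refine hfg a b _ fun i => ?_
      rcases eq_or_ne i j with rfl | h
      · simpa using ht
      · simpa [Function.update_of_ne h] using hx i
    · have h1 : ∫⁻ x, M x ^ p ≤ ∫⁻ x, C₁ * g x ^ p := by
        rw [volume_pi]
        -- The one-dimensional bound holds on each line parallel to the j-th axis, and Tonelli
        -- integrates it over the other coordinates.
        refine lintegral_le_of_lmarginal_le (μ := fun _ : ι => volume) {j} (hM.pow_const p)
          ((hg.pow_const p).const_mul _) fun x => ?_
        simp only [lmarginal_singleton]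
        have hgx : Measurable fun t => g (Function.update x j t) :=
          hg.comp (measurable_update x)
        rw [lintegral_const_mul _ (hgx.pow_const p)]
        simpa [M] using hC₁ _ hgx
      calc ∫⁻ x, (2 * M x) ^ p = 2 ^ p * ∫⁻ x, M x ^ p := by
            simp_rw [ENNReal.mul_rpow_of_nonneg _ _ hp0.le]
            exact lintegral_const_mul _ (hM.pow_const p)
        _ ≤ 2 ^ p * (C₁ * (C * ∫⁻ x, f x ^ p)) := by
            rw [lintegral_const_mul _ (hg.pow_const p)] at h1
            exact mul_le_mul_right (h1.trans (mul_le_mul_right hint _)) _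
        _ = _ := by
            push_cast
            rw [ENNReal.coe_rpow_of_nonneg _ hp0.le]
            push_cast
            ring

/-! ### Averages over rectangles and the multilinear L^p bound -/

/-- The multilinear strong maximal function of functions with values in `[0, ∞]`. -/
noncomputable def rectangleMaximal {d : ℕ} {ι : Type*} [Fintype ι]
    (F : ι → EuclideanSpace ℝ (Fin d) → ℝ≥0∞) (x : EuclideanSpace ℝ (Fin d)) : ℝ≥0∞ :=
  ⨆ (a : Fin d → ℝ) (b : Fin d → ℝ) (_ : x ∈ openRectangle a b),
    ∏ i, (volume (openRectangle a b))⁻¹ * ∫⁻ y in openRectangle a b, F i y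

theorem strongMaximal_eq_rectangleMaximal {d m : ℕ} {𝕜 : Type*} [RCLike 𝕜]
    (f : Fin m → EuclideanSpace ℝ (Fin d) → 𝕜) :
    strongMaximal f = rectangleMaximal fun i x => ‖f i x‖ₑ := rfl

theorem openRectangle_eq_preimage {d : ℕ} (a b : Fin d → ℝ) :
    openRectangle a b = (WithLp.ofLp (p := 2)) ⁻¹' Set.univ.pi fun j => Set.Ioo (a j) (b j) := by
  ext y; simp [openRectangle, Set.mem_pi]

theorem isOpen_openRectangle {d : ℕ} (a b : Fin d → ℝ) : IsOpen (openRectangle a b) := by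
  rw [openRectangle_eq_preimage]
  exact (isOpen_set_pi Set.finite_univ fun _ _ => isOpen_Ioo).preimage
    (PiLp.continuous_ofLp 2 _)

theorem volume_openRectangle {d : ℕ} (a b : Fin d → ℝ) :
    volume (openRectangle a b) = ∏ j, ENNReal.ofReal (b j - a j) := by
  rw [openRectangle_eq_preimage, (PiLp.volume_preserving_ofLp (Fin d)).measure_preimage
    (MeasurableSet.univ_pi fun _ => measurableSet_Ioo).nullMeasurableSet, volume_pi_pi]
  simp

/-- A supremum of nonnegative multiples of indicators of open sets is lower semicontinuous, whatever
F is. -/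
theorem measurable_rectangleMaximal {d : ℕ} {ι : Type*} [Fintype ι]
    (F : ι → EuclideanSpace ℝ (Fin d) → ℝ≥0∞) : Measurable (rectangleMaximal F) := by
  refine LowerSemicontinuous.measurable ?_
  refine lowerSemicontinuous_iSup fun a => lowerSemicontinuous_iSup fun b => ?_
  convert (isOpen_openRectangle a b).lowerSemicontinuous_indicator
    (y := ∏ i, (volume (openRectangle a b))⁻¹ * ∫⁻ y in openRectangle a b, F i y) bot_le using 1
  ext x
  by_cases hx : x ∈ openRectangle a b
  · rw [Set.indicator_of_mem hx, iSup_pos hx]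
  · rw [Set.indicator_of_notMem hx, iSup_neg hx, bot_eq_zero]

theorem pi_uniformIoo_eq {d : ℕ} (a b : Fin d → ℝ) :
    Measure.pi (fun j => uniformIoo (a j) (b j)) =
      (∏ j, ENNReal.ofReal (b j - a j))⁻¹ •
        volume.restrict (Set.univ.pi fun j => Set.Ioo (a j) (b j)) := by
  refine Measure.pi_eq fun s hs => ?_
  rw [Measure.smul_apply, Measure.restrict_apply (MeasurableSet.univ_pi hs), ← Set.pi_inter_distrib,
    volume_pi_pi, smul_eq_mul]
  simp only [uniformIoo, Measure.smul_apply, smul_eq_mul, Finset.prod_mul_distrib]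
  congr 1
  · rw [ENNReal.prod_inv_distrib]
    intro i _ j _ _
    exact Or.inr ENNReal.ofReal_ne_top
  · refine Finset.prod_congr rfl fun j _ => ?_
    rw [Measure.restrict_apply (hs j)]

theorem average_openRectangle_eq_lmarginal {d : ℕ} (f : EuclideanSpace ℝ (Fin d) → ℝ≥0∞)
    (a b : Fin d → ℝ) (x : Fin d → ℝ) :
    (volume (openRectangle a b))⁻¹ * ∫⁻ y in openRectangle a b, f y =
      (∫⋯∫⁻_Finset.univ, (fun y => f (WithLp.toLp 2 y)) ∂fun j => uniformIoo (a j) (b j)) x := by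
  rw [lmarginal_univ, pi_uniformIoo_eq, lintegral_smul_measure, smul_eq_mul,
    volume_openRectangle]
  congr 1
  have h := (PiLp.volume_preserving_ofLp (Fin d)).setLIntegral_comp_preimage_emb
    (MeasurableEquiv.toLp 2 (Fin d → ℝ)).symm.measurableEmbedding
    (fun y => f (WithLp.toLp 2 y)) (Set.univ.pi fun j => Set.Ioo (a j) (b j))
  rw [← h, openRectangle_eq_preimage]

theorem exists_average_openRectangle_majorant (d : ℕ) {p : ℝ} (hp : 1 < p) :
    ∃ C : ℝ≥0, ∀ f : EuclideanSpace ℝ (Fin d) → ℝ≥0∞, AEMeasurable f →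
      ∃ g : EuclideanSpace ℝ (Fin d) → ℝ≥0∞, Measurable g ∧
        (∀ a b x, x ∈ openRectangle a b →
          (volume (openRectangle a b))⁻¹ * ∫⁻ y in openRectangle a b, f y ≤ g x) ∧
        ∫⁻ x, g x ^ p ≤ C * ∫⁻ x, f x ^ p := by
  obtain ⟨C, hC⟩ := exists_lmarginal_uniformIoo_majorant hp (Finset.univ : Finset (Fin d))
  refine ⟨C, fun f hf => ?_⟩
  obtain ⟨g, hg, hfg, hint⟩ := hC (fun y => hf.mk f (WithLp.toLp 2 y))
    (hf.measurable_mk.comp (PiLp.volume_preserving_toLp (Fin d)).measurable)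
  refine ⟨fun x => g (WithLp.ofLp x), hg.comp (PiLp.volume_preserving_ofLp (Fin d)).measurable,
    fun a b x hx => ?_, ?_⟩
  · have e : ∫⁻ y in openRectangle a b, f y = ∫⁻ y in openRectangle a b, hf.mk f y :=
      lintegral_congr_ae (ae_restrict_of_ae hf.ae_eq_mk)
    rw [e, average_openRectangle_eq_lmarginal _ a b (WithLp.ofLp x)]
    exact hfg a b _ hx
  · have e : ∫⁻ x, f x ^ p = ∫⁻ x, hf.mk f x ^ p :=
      lintegral_congr_ae (hf.ae_eq_mk.mono fun x hx => by simp only [hx])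
    rw [e, (PiLp.volume_preserving_ofLp (Fin d)).lintegral_comp (hg.pow_const p)]
    rwa [← (PiLp.volume_preserving_toLp (Fin d)).lintegral_comp (hf.measurable_mk.pow_const p)]

/-- Each average is dominated by its own majorant, and Hölder's inequality with weights p / P i,
which sum to 1, separates the factors. -/
theorem lintegral_rectangleMaximal_rpow_le (d : ℕ) {ι : Type*} [Fintype ι] {p : ℝ} {P : ι → ℝ}
    (hP : ∀ i, 1 < P i) (hp : 0 < p) (hpP : 1 / p = ∑ i, 1 / P i) :
    ∃ C : ℝ≥0, ∀ F : ι → EuclideanSpace ℝ (Fin d) → ℝ≥0∞, (∀ i, AEMeasurable (F i)) →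
      (∫⁻ x, rectangleMaximal F x ^ p) ^ (1 / p) ≤ C * ∏ i, (∫⁻ x, F i x ^ P i) ^ (1 / P i) := by
  have hP0 : ∀ i, 0 < P i := fun i => zero_lt_one.trans (hP i)
  choose C hC using fun i => exists_average_openRectangle_majorant d (hP i)
  refine ⟨∏ i, C i ^ (1 / P i), fun F hF => ?_⟩
  choose g hg hFg hint using fun i => hC i (F i) (hF i)
  have hle : ∀ x, rectangleMaximal F x ≤ ∏ i, g i x := fun x =>
    iSup_le fun a => iSup_le fun b => iSup_le fun hx =>
      Finset.prod_le_prod' fun i _ => hFg i a b x hx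
  have hsum : ∑ i, p / P i = 1 := by
    simp_rw [div_eq_mul_one_div p, ← Finset.mul_sum, ← hpP]
    field_simp
  calc (∫⁻ x, rectangleMaximal F x ^ p) ^ (1 / p)
      ≤ (∫⁻ x, ∏ i, (g i x ^ P i) ^ (p / P i)) ^ (1 / p) := by
        gcongr with x
        refine (ENNReal.rpow_le_rpow (hle x) hp.le).trans_eq ?_
        rw [← ENNReal.prod_rpow_of_nonneg hp.le]
        refine Finset.prod_congr rfl fun i _ => ?_
        rw [← ENNReal.rpow_mul, mul_div_cancel₀ _ (hP0 i).ne']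
    _ ≤ (∏ i, (∫⁻ x, g i x ^ P i) ^ (p / P i)) ^ (1 / p) := by
        gcongr
        exact ENNReal.lintegral_prod_norm_pow_le _ (fun i _ => ((hg i).pow_const _).aemeasurable)
          hsum fun i _ => (div_pos hp (hP0 i)).le
    _ = ∏ i, (∫⁻ x, g i x ^ P i) ^ (1 / P i) := by
        rw [← ENNReal.prod_rpow_of_nonneg (by positivity)]
        refine Finset.prod_congr rfl fun i _ => ?_
        rw [← ENNReal.rpow_mul]
        congr 1
        have := hP0 i
        field_simp
    _ ≤ ∏ i, (C i * ∫⁻ x, F i x ^ P i) ^ (1 / P i) :=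
        Finset.prod_le_prod' fun i _ => ENNReal.rpow_le_rpow (hint i) (by have := hP0 i; positivity)
    _ = _ := by
        push_cast
        rw [← Finset.prod_mul_distrib]
        refine Finset.prod_congr rfl fun i _ => ?_
        have : 0 ≤ 1 / P i := by have := hP0 i; positivity
        rw [ENNReal.mul_rpow_of_nonneg _ _ this, ENNReal.coe_rpow_of_nonneg _ this]

/-! ### Multilinear difference estimates -/

/-- Telescoping, with every unchanged factor enlarged to a j + b j so that the error is symmetric in
a and b. -/
theorem ENNReal.prod_le_prod_add_sum {ι : Type*} [DecidableEq ι] (s : Finset ι)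
    {a b c : ι → ℝ≥0∞} (h : ∀ i, a i ≤ b i + c i) :
    ∏ i ∈ s, a i ≤ ∏ i ∈ s, b i + ∑ i ∈ s, c i * ∏ j ∈ s.erase i, (a j + b j) := by
  induction s using Finset.induction with
  | empty => simp
  | insert k s hk ih =>
    rw [Finset.prod_insert hk, Finset.prod_insert hk, Finset.sum_insert hk, Finset.erase_insert hk]
    have h1 : ∑ i ∈ s, c i * ∏ j ∈ (insert k s).erase i, (a j + b j) =
        (a k + b k) * ∑ i ∈ s, c i * ∏ j ∈ s.erase i, (a j + b j) := by
      rw [Finset.mul_sum]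
      refine Finset.sum_congr rfl fun i hi => ?_
      have hik : k ≠ i := fun e => hk (e ▸ hi)
      rw [Finset.erase_insert_of_ne hik, Finset.prod_insert (by simp [hk])]
      ring
    rw [h1]
    calc a k * ∏ i ∈ s, a i ≤ b k * ∏ i ∈ s, a i + c k * ∏ i ∈ s, a i := by
          rw [← add_mul]; exact mul_le_mul_left (h k) _
      _ ≤ b k * (∏ i ∈ s, b i + ∑ i ∈ s, c i * ∏ j ∈ s.erase i, (a j + b j)) +
          c k * ∏ i ∈ s, (a i + b i) := by
          gcongr with i hi
          exact le_self_add
      _ ≤ _ := by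
          rw [mul_add, add_assoc, add_comm _ (c k * _)]
          gcongr
          exact le_add_self

section Maximal

variable {d : ℕ} {ι : Type*} [Fintype ι] [DecidableEq ι]

/-- On a fixed rectangle the averages are additive, so the telescoped error terms are again products
of averages. The error is unchanged when F and G are swapped, which later gives a two-sided bound.
-/
theorem rectangleMaximal_le_add_sum {F G D : ι → EuclideanSpace ℝ (Fin d) → ℝ≥0∞}
    (hG : ∀ i, AEMeasurable (G i)) (h : ∀ i x, F i x ≤ G i x + D i x)
    (x : EuclideanSpace ℝ (Fin d)) :
    rectangleMaximal F x ≤ rectangleMaximal G x +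
      ∑ i, rectangleMaximal (Function.update (F + G) i (D i)) x := by
  refine iSup_le fun a => iSup_le fun b => iSup_le fun hx => ?_
  let A : (EuclideanSpace ℝ (Fin d) → ℝ≥0∞) → ℝ≥0∞ := fun f =>
    (volume (openRectangle a b))⁻¹ * ∫⁻ y in openRectangle a b, f y
  have hA : ∀ f {g : EuclideanSpace ℝ (Fin d) → ℝ≥0∞}, AEMeasurable g →
      A (f + g) = A f + A g := by
    intro f g hg
    simp only [A, Pi.add_apply]
    rw [lintegral_add_right' _ hg.restrict, mul_add]
  have hle : ∀ i, A (F i) ≤ A (D i) + A (G i) := by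
    intro i
    rw [← hA _ (hG i)]
    exact mul_le_mul_right (lintegral_mono fun y => (h i y).trans_eq (add_comm _ _)) _
  have hsup : ∀ H : ι → EuclideanSpace ℝ (Fin d) → ℝ≥0∞, ∏ i, A (H i) ≤ rectangleMaximal H x :=
    fun H => le_iSup_of_le a (le_iSup_of_le b (by rw [iSup_pos hx]))
  refine (ENNReal.prod_le_prod_add_sum Finset.univ
    (fun i => (hle i).trans_eq (add_comm _ _))).trans ?_
  refine add_le_add (hsup G) (Finset.sum_le_sum fun i _ => ?_)
  refine le_trans (le_of_eq ?_) (hsup _)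
  rw [← Finset.mul_prod_erase _ _ (Finset.mem_univ i), Function.update_self]
  congr 1
  refine Finset.prod_congr rfl fun j hj => ?_
  rw [Function.update_of_ne (Finset.ne_of_mem_erase hj), Pi.add_apply, hA _ (hG j)]

theorem eLpNorm_ofReal_eq_lintegral {α ε : Type*} [MeasurableSpace α] [ENorm ε] {μ : Measure α}
    {p : ℝ} (hp : 0 < p) (f : α → ε) :
    eLpNorm f (ENNReal.ofReal p) μ = (∫⁻ x, ‖f x‖ₑ ^ p ∂μ) ^ (1 / p) := by
  rw [eLpNorm_eq_lintegral_rpow_enorm_toReal (by simpa using hp) ENNReal.ofReal_ne_top,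
    ENNReal.toReal_ofReal hp.le]

omit [DecidableEq ι] in
theorem eLpNorm_rectangleMaximal_le (d : ℕ) {p : ℝ} {P : ι → ℝ}
    (hP : ∀ i, 1 < P i) (hp : 0 < p) (hpP : 1 / p = ∑ i, 1 / P i) :
    ∃ C : ℝ≥0, ∀ F : ι → EuclideanSpace ℝ (Fin d) → ℝ≥0∞, (∀ i, AEMeasurable (F i)) →
      eLpNorm (rectangleMaximal F) (ENNReal.ofReal p) volume ≤
        C * ∏ i, eLpNorm (F i) (ENNReal.ofReal (P i)) volume := by
  obtain ⟨C, hC⟩ := lintegral_rectangleMaximal_rpow_le d hP hp hpP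
  refine ⟨C, fun F hF => ?_⟩
  rw [eLpNorm_ofReal_eq_lintegral hp]
  simp only [fun i => eLpNorm_ofReal_eq_lintegral (μ := volume) (zero_lt_one.trans (hP i)) (F i),
    enorm_eq_self]
  exact hC F hF

/-- If c is finite, then a and b are infinite together, so sending ∞ to 0 does no harm. -/
theorem enorm_toReal_sub_le {a b c : ℝ≥0∞} (hab : a ≤ b + c) (hba : b ≤ a + c) :
    ‖a.toReal - b.toReal‖ₑ ≤ c := by
  rcases eq_or_ne c ∞ with rfl | hc
  · exact le_top
  rcases eq_or_ne a ∞ with rfl | ha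
  · have : b = ∞ := by simpa [hc] using hab
    simp [this]
  rcases eq_or_ne b ∞ with rfl | hb
  · exact absurd hba (by simp [ha, hc])
  lift a to ℝ≥0 using ha
  lift b to ℝ≥0 using hb
  lift c to ℝ≥0 using hc
  norm_cast at hab hba
  have h1 : (a : ℝ) ≤ b + c := by exact_mod_cast hab
  have h2 : (b : ℝ) ≤ a + c := by exact_mod_cast hba
  rw [Real.enorm_eq_ofReal_abs, ENNReal.coe_toReal, ENNReal.coe_toReal]
  refine (ENNReal.ofReal_le_ofReal (abs_le.2 ⟨?_, ?_⟩)).trans_eq (ENNReal.ofReal_coe_nnreal (p := c))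
  · linarith
  · linarith

theorem eLpNorm_enorm_eq {α ε : Type*} [MeasurableSpace α] [ENorm ε] {μ : Measure α}
    (p : ℝ≥0∞) (f : α → ε) : eLpNorm (fun x => ‖f x‖ₑ) p μ = eLpNorm f p μ :=
  le_antisymm (eLpNorm_mono_enorm fun x => by simp) (eLpNorm_mono_enorm fun x => by simp)

end Maximal

/-! ### L^p estimates and translation of the strong maximal function -/

section Strong

variable {d m : ℕ} {𝕜 : Type*} [RCLike 𝕜]

theorem measurable_strongMaximal (f : Fin m → EuclideanSpace ℝ (Fin d) → 𝕜) :
    Measurable (strongMaximal f) := measurable_rectangleMaximal _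

theorem measurable_strongMaximalReal (f : Fin m → EuclideanSpace ℝ (Fin d) → 𝕜) :
    Measurable (strongMaximalReal f) := (measurable_strongMaximal f).ennreal_toReal

theorem one_le_ofReal {p : ℝ} (hp : 1 < p) : 1 ≤ ENNReal.ofReal p := by
  rw [← ENNReal.ofReal_one]; exact ENNReal.ofReal_le_ofReal hp.le

theorem eLpNorm_strongMaximal_le (d : ℕ) (𝕜 : Type*) [RCLike 𝕜] {p : ℝ} {P : Fin m → ℝ}
    (hP : ∀ i, 1 < P i) (hp : 1 < p) (hpP : 1 / p = ∑ i, 1 / P i) :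
    ∃ C : ℝ≥0, ∀ f : Fin m → EuclideanSpace ℝ (Fin d) → 𝕜,
      (∀ i, AEStronglyMeasurable (f i) volume) →
      eLpNorm (strongMaximal f) (ENNReal.ofReal p) volume ≤
        C * ∏ i, eLpNorm (f i) (ENNReal.ofReal (P i)) volume := by
  obtain ⟨C, hC⟩ := eLpNorm_rectangleMaximal_le d hP (zero_lt_one.trans hp) hpP
  refine ⟨C, fun f hf => ?_⟩
  have := hC (fun i x => ‖f i x‖ₑ) fun i => (hf i).enorm
  simp only [eLpNorm_enorm_eq] at this
  rwa [strongMaximal_eq_rectangleMaximal]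

theorem eLpNorm_strongMaximalReal_sub_le (d : ℕ) (𝕜 : Type*) [RCLike 𝕜] {p : ℝ} {P : Fin m → ℝ}
    (hP : ∀ i, 1 < P i) (hp : 1 < p) (hpP : 1 / p = ∑ i, 1 / P i) :
    ∃ C : ℝ≥0, ∀ f g : Fin m → EuclideanSpace ℝ (Fin d) → 𝕜,
      (∀ i, AEStronglyMeasurable (f i) volume) → (∀ i, AEStronglyMeasurable (g i) volume) →
      eLpNorm (strongMaximalReal f - strongMaximalReal g) (ENNReal.ofReal p) volume ≤
        C * ∑ i, eLpNorm (f i - g i) (ENNReal.ofReal (P i)) volume *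
          ∏ j ∈ Finset.univ.erase i, (eLpNorm (f j) (ENNReal.ofReal (P j)) volume +
            eLpNorm (g j) (ENNReal.ofReal (P j)) volume) := by
  obtain ⟨C, hC⟩ := eLpNorm_rectangleMaximal_le d hP (zero_lt_one.trans hp) hpP
  refine ⟨C, fun f g hf hg => ?_⟩
  let F : Fin m → EuclideanSpace ℝ (Fin d) → ℝ≥0∞ := fun i x => ‖f i x‖ₑ
  let G : Fin m → EuclideanSpace ℝ (Fin d) → ℝ≥0∞ := fun i x => ‖g i x‖ₑ
  let D : Fin m → EuclideanSpace ℝ (Fin d) → ℝ≥0∞ := fun i x => ‖(f i - g i) x‖ₑ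
  have hF : ∀ i, AEMeasurable (F i) := fun i => (hf i).enorm
  have hG : ∀ i, AEMeasurable (G i) := fun i => (hg i).enorm
  have hD : ∀ i, AEMeasurable (D i) := fun i => ((hf i).sub (hg i)).enorm
  let S : Fin m → EuclideanSpace ℝ (Fin d) → ℝ≥0∞ := fun i =>
    rectangleMaximal (Function.update (F + G) i (D i))
  have hpt : ∀ x, ‖(strongMaximalReal f - strongMaximalReal g) x‖ₑ ≤ ‖(∑ i, S i) x‖ₑ := by
    intro x
    rw [enorm_eq_self, Finset.sum_apply]
    refine enorm_toReal_sub_le ?_ ?_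
    · refine rectangleMaximal_le_add_sum hG (fun i x => ?_) x
      have := enorm_add_le (g i x) ((f i - g i) x)
      rwa [Pi.sub_apply, add_sub_cancel] at this
    · have hS : S = fun i => rectangleMaximal (Function.update (G + F) i (D i)) := by
        simp only [S, add_comm]
      rw [hS]
      refine rectangleMaximal_le_add_sum hF (fun i x => ?_) x
      have := enorm_sub_le (a := f i x) (b := (f i - g i) x)
      rwa [Pi.sub_apply, sub_sub_cancel] at this
  refine (eLpNorm_mono_enorm hpt).trans ((eLpNorm_sum_le (fun i _ =>
    (measurable_rectangleMaximal _).aestronglyMeasurable) (one_le_ofReal hp)).trans ?_)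
  rw [Finset.mul_sum]
  refine Finset.sum_le_sum fun i _ => ?_
  refine (hC _ fun j => ?_).trans (mul_le_mul_right ?_ _)
  · rcases eq_or_ne j i with rfl | h
    · simpa using hD j
    · rw [Function.update_of_ne h]; exact (hF j).add (hG j)
  · rw [← Finset.mul_prod_erase _ _ (Finset.mem_univ i), Function.update_self, eLpNorm_enorm_eq]
    refine mul_le_mul_right (Finset.prod_le_prod' fun j hj => ?_) _
    rw [Function.update_of_ne (Finset.ne_of_mem_erase hj), Pi.add_apply,
      ← eLpNorm_enorm_eq _ (f j), ← eLpNorm_enorm_eq _ (g j)]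
    exact eLpNorm_add_le (hF j).aestronglyMeasurable (hG j).aestronglyMeasurable
      (one_le_ofReal (hP j))

theorem strongMaximal_add_le (f : Fin m → EuclideanSpace ℝ (Fin d) → 𝕜)
    (h x : EuclideanSpace ℝ (Fin d)) :
    strongMaximal f (x + h) ≤ strongMaximal (fun i y => f i (y + h)) x := by
  refine iSup_le fun a => iSup_le fun b => iSup_le fun hx => ?_
  have hpre : (· + h) ⁻¹' openRectangle a b =
      openRectangle (fun j => a j - h j) (fun j => b j - h j) := by
    ext y
    simp [openRectangle, sub_lt_iff_lt_add, lt_sub_iff_add_lt]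
  have hmp := measurePreserving_add_right (volume : Measure (EuclideanSpace ℝ (Fin d))) h
  have hx' : x ∈ openRectangle (fun j => a j - h j) (fun j => b j - h j) := hpre ▸ hx
  refine le_iSup_of_le (fun j => a j - h j) (le_iSup_of_le (fun j => b j - h j) ?_)
  rw [iSup_pos hx', ← hpre,
    hmp.measure_preimage (isOpen_openRectangle a b).measurableSet.nullMeasurableSet]
  refine Finset.prod_le_prod' fun i _ => mul_le_mul_right (le_of_eq ?_) _
  exact (hmp.setLIntegral_comp_preimage_emb (measurableEmbedding_addRight h)
    (fun y => ‖f i y‖ₑ) (openRectangle a b)).symm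

theorem strongMaximal_add (f : Fin m → EuclideanSpace ℝ (Fin d) → 𝕜)
    (h x : EuclideanSpace ℝ (Fin d)) :
    strongMaximal f (x + h) = strongMaximal (fun i y => f i (y + h)) x := by
  refine le_antisymm (strongMaximal_add_le f h x) ?_
  -- The reverse inequality is the same one for the translated functions, with shift -h.
  simpa using strongMaximal_add_le (fun i y => f i (y + h)) (-h) (x + h)

theorem strongMaximalReal_add (f : Fin m → EuclideanSpace ℝ (Fin d) → 𝕜)
    (h x : EuclideanSpace ℝ (Fin d)) :
    strongMaximalReal f (x + h) = strongMaximalReal (fun i y => f i (y + h)) x :=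
  congrArg ENNReal.toReal (strongMaximal_add f h x)

end Strong

/-! ### The L^p modulus of continuity -/

section Modulus

variable {d : ℕ} {𝕜 : Type*} [RCLike 𝕜]

/-- The measure `|h|^{-(d + s q)} dh` on `ℝ^d`. -/
noncomputable def besovMeasure (d : ℕ) (s q : ℝ) : Measure (EuclideanSpace ℝ (Fin d)) :=
  volume.withDensity fun h => (‖h‖ₑ ^ ((d : ℝ) + s * q))⁻¹

/-- The `L^p` modulus of continuity `h ↦ ‖f(· + h) - f‖_{L^p}`. -/
noncomputable def lpModulus (p : ℝ) (f : EuclideanSpace ℝ (Fin d) → 𝕜)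
    (h : EuclideanSpace ℝ (Fin d)) : ℝ≥0∞ :=
  eLpNorm (fun x => f (x + h) - f x) (ENNReal.ofReal p) volume

theorem measurable_lpModulus {p : ℝ} (hp : 0 < p) {f : EuclideanSpace ℝ (Fin d) → 𝕜}
    (hf : AEStronglyMeasurable f volume) : Measurable (lpModulus p f) := by
  have h1 : lpModulus p f = lpModulus p (hf.mk f) := by
    ext h
    refine eLpNorm_congr_ae ?_
    have h2 := (measurePreserving_add_right
      (volume : Measure (EuclideanSpace ℝ (Fin d))) h).quasiMeasurePreserving.ae_eq_comp
      hf.ae_eq_mk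
    filter_upwards [h2, hf.ae_eq_mk] with x hx hx'
    simp only [Function.comp_apply] at hx
    rw [hx, hx']
  have hm : Measurable (hf.mk f) := hf.stronglyMeasurable_mk.measurable
  rw [h1]
  unfold lpModulus
  simp_rw [eLpNorm_ofReal_eq_lintegral hp]
  have h3 : Measurable fun z : EuclideanSpace ℝ (Fin d) × EuclideanSpace ℝ (Fin d) =>
      ‖hf.mk f (z.2 + z.1) - hf.mk f z.2‖ₑ ^ p :=
    ((((hm.comp (measurable_snd.add measurable_fst)).sub
      (hm.comp measurable_snd))).enorm).pow_const p
  exact h3.lintegral_prod_right'.pow_const _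

/-- As an L^q norm of the modulus, the seminorm becomes accessible to Minkowski's inequality and
monotonicity. -/
theorem besovSeminorm_eq_eLpNorm {s p q : ℝ} (hp : 0 < p) (hq : 0 < q)
    {f : EuclideanSpace ℝ (Fin d) → 𝕜} (hf : AEStronglyMeasurable f volume) :
    besovSeminorm s p q f = eLpNorm (lpModulus p f) (ENNReal.ofReal q) (besovMeasure d s q) := by
  rw [eLpNorm_ofReal_eq_lintegral hq, besovMeasure, lintegral_withDensity_eq_lintegral_mul _
    (by fun_prop) (by simpa using (measurable_lpModulus hp hf).pow_const q)]
  simp [besovSeminorm, lpModulus, ENNReal.div_eq_inv_mul]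

theorem eLpNorm_comp_add_right (p : ℝ≥0∞) {f : EuclideanSpace ℝ (Fin d) → 𝕜}
    (hf : AEStronglyMeasurable f volume) (h : EuclideanSpace ℝ (Fin d)) :
    eLpNorm (fun x => f (x + h)) p volume = eLpNorm f p volume :=
  eLpNorm_comp_measurePreserving hf (measurePreserving_add_right _ h)

theorem aestronglyMeasurable_comp_add_right {f : EuclideanSpace ℝ (Fin d) → 𝕜}
    (hf : AEStronglyMeasurable f volume) (h : EuclideanSpace ℝ (Fin d)) :
    AEStronglyMeasurable (fun x => f (x + h)) volume :=
  hf.comp_measurePreserving (measurePreserving_add_right _ h)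

theorem lpModulus_add_le {p : ℝ} (hp : 1 < p) {f g : EuclideanSpace ℝ (Fin d) → 𝕜}
    (hf : AEStronglyMeasurable f volume) (hg : AEStronglyMeasurable g volume)
    (h : EuclideanSpace ℝ (Fin d)) :
    lpModulus p (f + g) h ≤ lpModulus p f h + lpModulus p g h := by
  refine le_trans (le_of_eq ?_) (eLpNorm_add_le
    ((aestronglyMeasurable_comp_add_right hf h).sub hf)
    ((aestronglyMeasurable_comp_add_right hg h).sub hg) (one_le_ofReal hp))
  unfold lpModulus
  congr 1
  ext x
  simp only [Pi.add_apply]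
  ring

theorem lpModulus_sub_le {p : ℝ} (hp : 1 < p) {f g : EuclideanSpace ℝ (Fin d) → 𝕜}
    (hf : AEStronglyMeasurable f volume) (hg : AEStronglyMeasurable g volume)
    (h : EuclideanSpace ℝ (Fin d)) :
    lpModulus p (f - g) h ≤ lpModulus p f h + lpModulus p g h := by
  refine le_trans (le_of_eq ?_) (eLpNorm_sub_le
    ((aestronglyMeasurable_comp_add_right hf h).sub hf)
    ((aestronglyMeasurable_comp_add_right hg h).sub hg) (one_le_ofReal hp))
  unfold lpModulus
  congr 1
  ext x
  simp only [Pi.sub_apply]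
  ring

theorem lpModulus_le_two_mul {p : ℝ} (hp : 1 < p) {f : EuclideanSpace ℝ (Fin d) → 𝕜}
    (hf : AEStronglyMeasurable f volume) (h : EuclideanSpace ℝ (Fin d)) :
    lpModulus p f h ≤ 2 * eLpNorm f (ENNReal.ofReal p) volume := by
  refine (eLpNorm_sub_le (aestronglyMeasurable_comp_add_right hf h) hf
    (one_le_ofReal hp)).trans_eq ?_
  rw [eLpNorm_comp_add_right _ hf, two_mul]

/-- Translating Mf amounts to translating the f_i, so this is the difference estimate for f(· + h)
and f. -/
theorem lpModulus_strongMaximalReal_le {m : ℕ} (d : ℕ) (𝕜 : Type*) [RCLike 𝕜] {p : ℝ}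
    {P : Fin m → ℝ} (hP : ∀ i, 1 < P i) (hp : 1 < p) (hpP : 1 / p = ∑ i, 1 / P i) :
    ∃ C : ℝ≥0, ∀ f : Fin m → EuclideanSpace ℝ (Fin d) → 𝕜,
      (∀ i, AEStronglyMeasurable (f i) volume) → ∀ h,
      lpModulus p (strongMaximalReal f) h ≤ C * ∑ i, lpModulus (P i) (f i) h *
        ∏ j ∈ Finset.univ.erase i, (2 * eLpNorm (f j) (ENNReal.ofReal (P j)) volume) := by
  obtain ⟨C, hC⟩ := eLpNorm_strongMaximalReal_sub_le d 𝕜 hP hp hpP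
  refine ⟨C, fun f hf h => ?_⟩
  have := hC (fun i x => f i (x + h)) f (fun i => aestronglyMeasurable_comp_add_right (hf i) h) hf
  simp only [fun j => eLpNorm_comp_add_right (ENNReal.ofReal (P j)) (hf j) h, ← two_mul] at this
  refine le_trans (le_of_eq ?_) this
  unfold lpModulus
  congr 1
  ext x
  rw [Pi.sub_apply, strongMaximalReal_add]

end Modulus

/-! ### Boundedness and continuity on Besov spaces -/

theorem eLpNorm_const_mul_ennreal {α : Type*} [MeasurableSpace α] {μ : Measure α} {q : ℝ}
    (hq : 0 < q) (c : ℝ≥0∞) {A : α → ℝ≥0∞} (hA : Measurable A) :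
    eLpNorm (fun x => c * A x) (ENNReal.ofReal q) μ = c * eLpNorm A (ENNReal.ofReal q) μ := by
  rw [eLpNorm_ofReal_eq_lintegral hq, eLpNorm_ofReal_eq_lintegral hq]
  simp only [enorm_eq_self, ENNReal.mul_rpow_of_nonneg _ _ hq.le]
  rw [lintegral_const_mul _ (hA.pow_const q), ENNReal.mul_rpow_of_nonneg _ _ (by positivity),
    ← ENNReal.rpow_mul, mul_one_div_cancel hq.ne', ENNReal.rpow_one]

/-- Dominated convergence with majorant F ^ q. In the continuity proof t is a uniform bound that
shrinks with δ. -/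
theorem tendsto_eLpNorm_min_const {α : Type*} [MeasurableSpace α] {μ : Measure α} {q : ℝ}
    (hq : 0 < q) {F : α → ℝ≥0∞} (hF : Measurable F)
    (hfin : eLpNorm F (ENNReal.ofReal q) μ ≠ ∞) :
    Filter.Tendsto (fun t : ℝ≥0∞ => eLpNorm (fun x => min t (F x)) (ENNReal.ofReal q) μ)
      (nhds 0) (nhds 0) := by
  simp only [eLpNorm_ofReal_eq_lintegral hq, enorm_eq_self] at hfin ⊢
  have hfin' : ∫⁻ x, F x ^ q ∂μ ≠ ∞ := fun h => hfin (by simp [h, hq])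
  have h0 : Filter.Tendsto (fun t : ℝ≥0∞ => ∫⁻ x, min t (F x) ^ q ∂μ) (nhds 0)
      (nhds (∫⁻ _, 0 ∂μ)) := by
    refine tendsto_lintegral_filter_of_dominated_convergence (fun x => F x ^ q)
      (Filter.Eventually.of_forall fun t => (measurable_const.min hF).pow_const q)
      (Filter.Eventually.of_forall fun t => Filter.Eventually.of_forall fun x =>
        ENNReal.rpow_le_rpow (min_le_right _ _) hq.le) hfin'
      (Filter.Eventually.of_forall fun x => ?_)
    have hc : Continuous fun t : ℝ≥0∞ => min t (F x) ^ q :=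
      ENNReal.continuous_rpow_const.comp (continuous_id.min continuous_const)
    simpa [hq] using hc.tendsto 0
  have := (ENNReal.continuous_rpow_const (y := 1 / q)).continuousAt.tendsto.comp h0
  simpa [Function.comp_def, hq] using this

theorem ENNReal.prod_erase_le_prod_of_one_le {ι : Type*} [DecidableEq ι] (s : Finset ι) (i : ι)
    {A : ι → ℝ≥0∞} (hA : ∀ j, 1 ≤ A j) : ∏ j ∈ s.erase i, A j ≤ ∏ j ∈ s, A j :=
  Finset.prod_le_prod_of_subset_of_one_le' (Finset.erase_subset _ _) fun j _ _ => hA j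

section Besov

variable {d m : ℕ} {𝕜 : Type*} [RCLike 𝕜]

theorem exists_besovNorm_strongMaximalReal_le (d : ℕ) (𝕜 : Type*) [RCLike 𝕜] {s p q : ℝ}
    {P : Fin m → ℝ} (hP : ∀ i, 1 < P i) (hp : 1 < p) (hq : 1 < q)
    (hpP : 1 / p = ∑ i, 1 / P i) :
    ∃ C : ℝ≥0, ∀ f : Fin m → EuclideanSpace ℝ (Fin d) → 𝕜,
      (∀ i, MemBesov s (P i) q (f i)) →
        (∀ᵐ x, strongMaximal f x < ∞) ∧
        MemBesov s p q (strongMaximalReal f) ∧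
        besovNorm s p q (strongMaximalReal f) ≤ C * ∏ i, besovNorm s (P i) q (f i) := by
  have hp0 : 0 < p := zero_lt_one.trans hp
  have hq0 : 0 < q := zero_lt_one.trans hq
  have hP0 : ∀ i, 0 < P i := fun i => zero_lt_one.trans (hP i)
  obtain ⟨C₀, hC₀⟩ := eLpNorm_strongMaximal_le d 𝕜 hP hp hpP
  obtain ⟨C₁, hC₁⟩ := lpModulus_strongMaximalReal_le d 𝕜 hP hp hpP
  -- C₀ serves the L^p part; the seminorm part is a sum of m terms, each with one factor 2 per
  -- function.
  refine ⟨C₀ + C₁ * (m * 2 ^ m), fun f hf => ?_⟩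
  have hfm : ∀ i, AEStronglyMeasurable (f i) volume := fun i => (hf i).1
  set B : Fin m → ℝ≥0∞ := fun i => besovNorm s (P i) q (f i)
  have hN : ∀ i, eLpNorm (f i) (ENNReal.ofReal (P i)) volume ≤ B i := fun i => le_self_add
  have hBtop : ∏ i, B i ≠ ∞ := ENNReal.prod_ne_top fun i _ => (hf i).2.ne
  have hSM : eLpNorm (strongMaximal f) (ENNReal.ofReal p) volume ≤ C₀ * ∏ i, B i :=
    (hC₀ f hfm).trans (mul_le_mul_right (Finset.prod_le_prod' fun i _ => hN i) _)
  have hSMR : eLpNorm (strongMaximalReal f) (ENNReal.ofReal p) volume ≤ C₀ * ∏ i, B i := by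
    refine (eLpNorm_mono_enorm fun x => ?_).trans hSM
    rw [strongMaximalReal, Real.enorm_eq_ofReal ENNReal.toReal_nonneg, enorm_eq_self]
    exact ENNReal.ofReal_toReal_le
  have hsemi : besovSeminorm s p q (strongMaximalReal f) ≤ C₁ * (m * 2 ^ m) * ∏ i, B i := by
    rw [besovSeminorm_eq_eLpNorm hp0 hq0 (measurable_strongMaximalReal f).aestronglyMeasurable]
    let D : Fin m → ℝ≥0∞ := fun i =>
      C₁ * ∏ j ∈ Finset.univ.erase i, (2 * eLpNorm (f j) (ENNReal.ofReal (P j)) volume)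
    have hmod : ∀ i, Measurable (lpModulus (P i) (f i)) := fun i =>
      measurable_lpModulus (hP0 i) (hfm i)
    calc eLpNorm (lpModulus p (strongMaximalReal f)) (ENNReal.ofReal q) (besovMeasure d s q)
        ≤ eLpNorm (∑ i, fun h => D i * lpModulus (P i) (f i) h) (ENNReal.ofReal q)
            (besovMeasure d s q) := by
          refine eLpNorm_mono_enorm fun h => ?_
          rw [enorm_eq_self, enorm_eq_self, Finset.sum_apply]
          refine (hC₁ f hfm h).trans_eq ?_
          rw [Finset.mul_sum]
          exact Finset.sum_congr rfl fun i _ => by simp only [D]; ring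
      _ ≤ ∑ i, eLpNorm (fun h => D i * lpModulus (P i) (f i) h) (ENNReal.ofReal q)
            (besovMeasure d s q) :=
          eLpNorm_sum_le (fun i _ => ((hmod i).const_mul _).aestronglyMeasurable)
            (one_le_ofReal hq)
      _ ≤ ∑ _i : Fin m, C₁ * (2 ^ m * ∏ j, B j) := by
          refine Finset.sum_le_sum fun i _ => ?_
          rw [eLpNorm_const_mul_ennreal hq0 _ (hmod i),
            ← besovSeminorm_eq_eLpNorm (hP0 i) hq0 (hfm i)]
          have h1 : besovSeminorm s (P i) q (f i) ≤ 2 * B i :=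
            (le_add_self : _ ≤ B i).trans (by rw [two_mul]; exact le_self_add)
          calc D i * besovSeminorm s (P i) q (f i)
              ≤ (C₁ * ∏ j ∈ Finset.univ.erase i, (2 * B j)) * (2 * B i) :=
                mul_le_mul' (mul_le_mul_right (Finset.prod_le_prod' fun j _ =>
                  mul_le_mul_right (hN j) _) _) h1
            _ = C₁ * ∏ j, (2 * B j) := by
                rw [mul_assoc, Finset.prod_erase_mul _ _ (Finset.mem_univ i)]
            _ = C₁ * (2 ^ m * ∏ j, B j) := by simp [Finset.prod_mul_distrib]
      _ = C₁ * (m * 2 ^ m) * ∏ i, B i := by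
          simp only [Finset.sum_const, Finset.card_univ, Fintype.card_fin, nsmul_eq_mul]
          ring
  have hnorm : besovNorm s p q (strongMaximalReal f) ≤
      ((C₀ + C₁ * (m * 2 ^ m) : ℝ≥0) : ℝ≥0∞) * ∏ i, B i := by
    push_cast
    rw [add_mul]
    exact add_le_add hSMR hsemi
  refine ⟨?_, ⟨(measurable_strongMaximalReal f).aestronglyMeasurable,
    hnorm.trans_lt (ENNReal.mul_lt_top ENNReal.coe_lt_top hBtop.lt_top)⟩, hnorm⟩
  have hfin := hSM.trans_lt (ENNReal.mul_lt_top ENNReal.coe_lt_top hBtop.lt_top)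
  rw [eLpNorm_ofReal_eq_lintegral hp0, ENNReal.rpow_lt_top_iff_of_pos (by positivity)] at hfin
  filter_upwards [ae_lt_top ((measurable_strongMaximal f).pow_const p) hfin.ne] with x hx
  rwa [ENNReal.rpow_lt_top_iff_of_pos hp0] at hx

/-- The L^p part is locally Lipschitz. The seminorm has no such estimate here; smallness comes from
the L^p bound and integrability from a majorant depending only on f. -/
theorem exists_besovNorm_strongMaximalReal_sub_lt {s p q : ℝ} {P : Fin m → ℝ}
    (hP : ∀ i, 1 < P i) (hp : 1 < p) (hq : 1 < q) (hpP : 1 / p = ∑ i, 1 / P i)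
    (f : Fin m → EuclideanSpace ℝ (Fin d) → 𝕜) (hf : ∀ i, MemBesov s (P i) q (f i))
    (ε : ℝ≥0∞) (hε : 0 < ε) :
    ∃ δ : ℝ≥0∞, 0 < δ ∧ ∀ g : Fin m → EuclideanSpace ℝ (Fin d) → 𝕜,
      (∀ i, MemBesov s (P i) q (g i)) → (∀ i, besovNorm s (P i) q (g i - f i) < δ) →
        besovNorm s p q (strongMaximalReal g - strongMaximalReal f) < ε := by
  have hp0 : 0 < p := zero_lt_one.trans hp
  have hq0 : 0 < q := zero_lt_one.trans hq
  have hP0 : ∀ i, 0 < P i := fun i => zero_lt_one.trans (hP i)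
  obtain ⟨C₀, hC₀⟩ := eLpNorm_strongMaximalReal_sub_le d 𝕜 hP hp hpP
  obtain ⟨C₁, hC₁⟩ := lpModulus_strongMaximalReal_le d 𝕜 hP hp hpP
  have hfm : ∀ i, AEStronglyMeasurable (f i) volume := fun i => (hf i).1
  let N : Fin m → ℝ≥0∞ := fun j => eLpNorm (f j) (ENNReal.ofReal (P j)) volume
  -- For δ < 1 this dominates both ‖g_j‖ + ‖f_j‖ and twice either norm; being at least 1, it lets
  -- the erased factor be restored.
  let A : Fin m → ℝ≥0∞ := fun j => 2 * (N j + 1)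
  have hNtop : ∀ j, N j ≠ ∞ := fun j => (le_self_add.trans_lt (hf j).2).ne
  have hA1 : ∀ j, 1 ≤ A j := fun j =>
    (le_add_self : 1 ≤ N j + 1).trans (by simp only [A, two_mul]; exact le_self_add)
  let K : ℝ≥0∞ := (C₀ + C₁) * ∏ j, A j
  have hK : K ≠ ∞ := ENNReal.mul_ne_top (by simp) (ENNReal.prod_ne_top fun j _ =>
    ENNReal.mul_ne_top (by simp) (by simp [hNtop j]))
  -- The factor 2 arises because the moduli of Mf and Mg each contribute the moduli of the f_i.
  let F : EuclideanSpace ℝ (Fin d) → ℝ≥0∞ := fun h => 2 * K * ∑ i, lpModulus (P i) (f i) h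
  have hmod : ∀ i, Measurable (lpModulus (P i) (f i)) := fun i =>
    measurable_lpModulus (hP0 i) (hfm i)
  have hsum : Measurable fun h => ∑ i, lpModulus (P i) (f i) h :=
    Finset.measurable_fun_sum _ fun i _ => hmod i
  have hF : Measurable F := hsum.const_mul _
  have hFfin : eLpNorm F (ENNReal.ofReal q) (besovMeasure d s q) ≠ ∞ := by
    simp only [F]
    rw [eLpNorm_const_mul_ennreal hq0 _ hsum]
    refine ENNReal.mul_ne_top (ENNReal.mul_ne_top (by simp) hK) (ne_top_of_le_ne_top
      (b := ∑ i, besovSeminorm s (P i) q (f i))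
      (ENNReal.sum_ne_top.2 fun i _ => (le_add_self.trans_lt (hf i).2).ne) ?_)
    simp_rw [fun i => besovSeminorm_eq_eLpNorm (s := s) (hP0 i) hq0 (hfm i)]
    have := eLpNorm_sum_le (s := Finset.univ) (μ := besovMeasure d s q)
      (fun i _ => (hmod i).aestronglyMeasurable) (one_le_ofReal hq)
    rwa [Finset.sum_fn] at this
  -- The final bound: the L^p norm of the difference, the truncated fixed majorant, and the
  -- seminorms of the g_i - f_i.
  let Ψ : ℝ≥0∞ → ℝ≥0∞ := fun δ => K * m * δ +
    (eLpNorm (fun h => min (2 * (K * m * δ)) (F h)) (ENNReal.ofReal q) (besovMeasure d s q) +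
      K * m * δ)
  have hlin : Filter.Tendsto (fun δ : ℝ≥0∞ => K * m * δ) (nhds 0) (nhds 0) := by
    have := ENNReal.Tendsto.const_mul (a := K * m) (Filter.tendsto_id (x := nhds (0 : ℝ≥0∞)))
      (Or.inr (ENNReal.mul_ne_top hK (by simp)))
    simpa using this
  have hlin2 : Filter.Tendsto (fun δ : ℝ≥0∞ => 2 * (K * m * δ)) (nhds 0) (nhds 0) := by
    simpa using ENNReal.Tendsto.const_mul (a := 2) hlin (Or.inr (by simp))
  have hΨ : Filter.Tendsto Ψ (nhds 0) (nhds 0) := by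
    simpa using hlin.add (((tendsto_eLpNorm_min_const hq0 hF hFfin).comp hlin2).add hlin)
  have hev : ∀ᶠ δ in nhdsWithin (0 : ℝ≥0∞) (Set.Ioi 0), Ψ δ < ε ∧ δ < 1 ∧ 0 < δ :=
    ((hΨ.eventually (gt_mem_nhds hε)).filter_mono nhdsWithin_le_nhds).and
      (((gt_mem_nhds zero_lt_one).filter_mono nhdsWithin_le_nhds).and self_mem_nhdsWithin)
  obtain ⟨δ, hδε, hδ1, hδ0⟩ := hev.exists
  refine ⟨δ, hδ0, fun g hg hfg => lt_of_le_of_lt ?_ hδε⟩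
  have hgm : ∀ i, AEStronglyMeasurable (g i) volume := fun i => (hg i).1
  have hdm : ∀ i, AEStronglyMeasurable (g i - f i) volume := fun i => (hgm i).sub (hfm i)
  have hdN : ∀ i, eLpNorm (g i - f i) (ENNReal.ofReal (P i)) volume ≤ δ := fun i =>
    le_self_add.trans (hfg i).le
  have hdS : ∀ i, besovSeminorm s (P i) q (g i - f i) ≤ δ := fun i =>
    le_add_self.trans (hfg i).le
  have hgN : ∀ i, eLpNorm (g i) (ENNReal.ofReal (P i)) volume ≤ N i + 1 := by
    intro i
    have := eLpNorm_add_le (hfm i) (hdm i) (one_le_ofReal (hP i))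
    rw [add_sub_cancel] at this
    exact this.trans (add_le_add le_rfl ((hdN i).trans hδ1.le))
  have hfN : ∀ i, N i ≤ N i + 1 := fun i => le_self_add
  have hdiffm : AEStronglyMeasurable (strongMaximalReal g - strongMaximalReal f) volume :=
    ((measurable_strongMaximalReal g).sub (measurable_strongMaximalReal f)).aestronglyMeasurable
  have hLp : eLpNorm (strongMaximalReal g - strongMaximalReal f) (ENNReal.ofReal p) volume ≤
      K * m * δ := by
    refine (hC₀ g f hgm hfm).trans ?_
    calc (C₀ : ℝ≥0∞) * ∑ i, eLpNorm (g i - f i) (ENNReal.ofReal (P i)) volume *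
          ∏ j ∈ Finset.univ.erase i, (eLpNorm (g j) (ENNReal.ofReal (P j)) volume + N j)
        ≤ (C₀ + C₁) * ∑ _i : Fin m, δ * ∏ j, A j := by
          refine mul_le_mul' le_self_add (Finset.sum_le_sum fun i _ => mul_le_mul' (hdN i) ?_)
          refine (Finset.prod_le_prod' fun j _ => ?_).trans
            (ENNReal.prod_erase_le_prod_of_one_le _ i hA1)
          simp only [A, two_mul]
          exact add_le_add (hgN j) (hfN j)
      _ = K * m * δ := by
          simp only [Finset.sum_const, Finset.card_univ, Fintype.card_fin, nsmul_eq_mul, K]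
          ring
  have hmodle : ∀ u : Fin m → EuclideanSpace ℝ (Fin d) → 𝕜,
      (∀ i, AEStronglyMeasurable (u i) volume) →
      (∀ i, eLpNorm (u i) (ENNReal.ofReal (P i)) volume ≤ N i + 1) → ∀ h,
      lpModulus p (strongMaximalReal u) h ≤ K * ∑ i, lpModulus (P i) (u i) h := by
    intro u hum hu h
    refine (hC₁ u hum h).trans ?_
    calc (C₁ : ℝ≥0∞) * ∑ i, lpModulus (P i) (u i) h *
          ∏ j ∈ Finset.univ.erase i, (2 * eLpNorm (u j) (ENNReal.ofReal (P j)) volume)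
        ≤ (C₀ + C₁) * ∑ i, lpModulus (P i) (u i) h * ∏ j, A j := by
          refine mul_le_mul' le_add_self (Finset.sum_le_sum fun i _ => mul_le_mul_right ?_ _)
          exact (Finset.prod_le_prod' fun j _ => mul_le_mul_right (hu j) _).trans
            (ENNReal.prod_erase_le_prod_of_one_le _ i hA1)
      _ = K * ∑ i, lpModulus (P i) (u i) h := by
          rw [← Finset.sum_mul]; simp only [K]; ring
  let E : Fin m → EuclideanSpace ℝ (Fin d) → ℝ≥0∞ := fun i => lpModulus (P i) (g i - f i)
  have hE : ∀ i, Measurable (E i) := fun i => measurable_lpModulus (hP0 i) (hdm i)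
  have hEsum : Measurable fun h => ∑ i, E i h := Finset.measurable_fun_sum _ fun i _ => hE i
  have hpt : ∀ h, lpModulus p (strongMaximalReal g - strongMaximalReal f) h ≤
      min (2 * (K * m * δ)) (F h) + K * ∑ i, E i h := by
    intro h
    -- The two bounds on the modulus are proved separately; the uniform one simply discards the sum
    -- of the E i.
    rw [min_add]
    refine le_min ?_ ?_
    · exact ((lpModulus_le_two_mul hp hdiffm h).trans (mul_le_mul_right hLp _)).trans le_self_add
    · have h1 := lpModulus_sub_le hp (measurable_strongMaximalReal g).aestronglyMeasurable
        (measurable_strongMaximalReal f).aestronglyMeasurable h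
      have h2 : ∑ i, lpModulus (P i) (g i) h ≤
          ∑ i, lpModulus (P i) (f i) h + ∑ i, E i h := by
        rw [← Finset.sum_add_distrib]
        refine Finset.sum_le_sum fun i _ => ?_
        simpa [add_sub_cancel] using lpModulus_add_le (hP i) (hfm i) (hdm i) h
      calc _ ≤ K * (∑ i, lpModulus (P i) (f i) h + ∑ i, E i h) +
            K * ∑ i, lpModulus (P i) (f i) h :=
            h1.trans (add_le_add ((hmodle g hgm hgN h).trans (mul_le_mul_right h2 _))
              (hmodle f hfm hfN h))
        _ = F h + K * ∑ i, E i h := by simp only [F]; ring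
  refine add_le_add hLp ?_
  rw [besovSeminorm_eq_eLpNorm hp0 hq0 hdiffm]
  refine (eLpNorm_mono_enorm (g := (fun h => min (2 * (K * m * δ)) (F h)) +
    fun h => K * ∑ i, E i h) fun h => by simpa using hpt h).trans ?_
  refine (eLpNorm_add_le (measurable_const.min hF).aestronglyMeasurable
    (hEsum.const_mul K).aestronglyMeasurable (one_le_ofReal hq)).trans ?_
  have hEδ : eLpNorm (fun h => ∑ i, E i h) (ENNReal.ofReal q) (besovMeasure d s q) ≤ m * δ := by
    have h3 := eLpNorm_sum_le (s := Finset.univ) (μ := besovMeasure d s q)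
      (fun i _ => (hE i).aestronglyMeasurable) (one_le_ofReal hq)
    rw [Finset.sum_fn] at h3
    refine h3.trans ((Finset.sum_le_sum fun i _ => ?_).trans_eq
      (b := ∑ _i : Fin m, δ) (by simp))
    rw [← besovSeminorm_eq_eLpNorm (hP0 i) hq0 (hdm i)]
    exact hdS i
  refine add_le_add le_rfl ?_
  rw [eLpNorm_const_mul_ennreal hq0 _ hEsum, mul_assoc K (m : ℝ≥0∞) δ]
  exact mul_le_mul_right hEδ K

end Besov

theorem theorem1p2 {𝕜 : Type*} [RCLike 𝕜] (d m : ℕ) (hd : 1 ≤ d)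
    (s p q : ℝ) (P : Fin m → ℝ) (hs0 : 0 < s) (hs1 : s < 1)
    (hP : ∀ i, 1 < P i) (hp : 1 < p) (hq : 1 < q) (hpP : 1 / p = ∑ i, 1 / P i) :
    -- boundedness, including that the maximal function is finite almost everywhere
    (∃ C : ℝ≥0, ∀ f : Fin m → EuclideanSpace ℝ (Fin d) → 𝕜,
      (∀ i, MemBesov s (P i) q (f i)) →
        (∀ᵐ x, strongMaximal f x < ∞) ∧
        MemBesov s p q (strongMaximalReal f) ∧
        besovNorm s p q (strongMaximalReal f) ≤ C * ∏ i, besovNorm s (P i) q (f i)) ∧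
    -- continuity at every point of the product space
    (∀ f : Fin m → EuclideanSpace ℝ (Fin d) → 𝕜, (∀ i, MemBesov s (P i) q (f i)) →
      ∀ ε : ℝ≥0∞, 0 < ε → ∃ δ : ℝ≥0∞, 0 < δ ∧
        ∀ g : Fin m → EuclideanSpace ℝ (Fin d) → 𝕜, (∀ i, MemBesov s (P i) q (g i)) →
          (∀ i, besovNorm s (P i) q (g i - f i) < δ) →
            besovNorm s p q (strongMaximalReal g - strongMaximalReal f) < ε) := by
  exact ⟨exists_besovNorm_strongMaximalReal_le d 𝕜 hP hp hq hpP,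
    fun f hf ε hε => exists_besovNorm_strongMaximalReal_sub_lt hP hp hq hpP f hf ε hε⟩
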